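/- Fix $p\in[0,1]$. For each $N$ let $\boldsymbol d=(d_i)_{i\in[N]}$ be a degree sequence with $\lfloor pN\rfloor$ vertices of degree $2$ and $N-\lfloor pN\rfloor$ vertices of degree $1$, where $N$ is restricted to those values for which $\ell_N=\sum_i d_i=N+\lfloor pN\rfloor$ is even. Let $G_N=\mathrm{CM}_N(\mathbf 1,\mathbf 2)$ be the configuration model with this degree sequence, i.e. the random multigraph on $[N]$ obtained from a uniformly random perfect matching of the $\ell_N$ half-edges ($d_i$ of them attached to vertex $i$), and let $Q_N$ be its law (and the corresponding expectation). For $\beta\ge 0$, $B\in\mathbb R$ and $\sigma\in\{-1,1\}^N$ define the annealed measure $$\widetilde P_N(\sigma)=\frac{Q_N\big(\exp[\beta\sum_{(i,j)\in E_N}\sigma_i\sigma_j+B\sum_{i\in[N]}\sigma_i]\big)}{Q_N(Z_N(\beta,B))},\qquad Z_N(\beta,B)=\sum_{\sigma\in\{-1,1\}^N}\exp\Big[\beta\sum_{(i,j)\in E_N}\sigma_i\sigma_j+B\sum_{i\in[N]}\sigma_i\Big],$$ where the edges are counted with multiplicity (a self-loop being one edge), and let $S_N=\sum_{i\in[N]}\sigma_i$.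 Then for all $\beta\ge0$ and $B\in\mathbb R$ the limits $$\widetilde\psi(\beta,B)=\lim_{N\to\infty}\frac1N\log Q_N(Z_N(\beta,B)),\qquad \widetilde M(\beta,B)=\lim_{N\to\infty}\widetilde P_N\Big(\frac{S_N}{N}\Big)$$ exist and depend only on $p,\beta,B$; $\widetilde\psi(\beta,\cdot)$ is differentiable with $\widetilde M(\beta,B)=\frac{\partial}{\partial B}\widetilde\psi(\beta,B)$; and for every $\varepsilon>0$ there is a number $L=L(\varepsilon)>0$ such that $$\widetilde P_N\Big(\Big|\frac{S_N}{N}-\widetilde M(\beta,B)\Big|\ge\varepsilon\Big)\le e^{-NL}\qquad\text{for all sufficiently large } N.$$ -/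

import Mathlib

open Filter Topology

noncomputable section

namespace AnnealedIsing

/-- The half-edges of a degree sequence `d` on the vertex set `Fin N`: `d i` of them sit at vertex `i`. -/
abbrev HalfEdge {N : ℕ} (d : Fin N → ℕ) : Type := Σ i : Fin N, Fin (d i)

/-- The pairings of the half-edges, i.e. the fixed-point-free involutions of the set of half-edges.
The half-edge `h` is joined to `π h`. Self-loops and multiple edges of the resulting multigraph
are allowed. -/
def pairings {N : ℕ} (d : Fin N → ℕ) : Finset (Equiv.Perm (HalfEdge d)) :=
  Finset.univ.filter fun π => (∀ h, π (π h) = h) ∧ ∀ h, π h ≠ h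

/-- Expectation with respect to the law of the configuration model with degree sequence `d`:
the pairing is uniform among all pairings of the half-edges. -/
def graphExpect {N : ℕ} (d : Fin N → ℕ) (X : Equiv.Perm (HalfEdge d) → ℝ) : ℝ :=
  (∑ π ∈ pairings d, X π) / (pairings d).card

/-- Spin configurations: elements of `{-1, 1}^N`. -/
abbrev Spins (N : ℕ) : Type := Fin N → ℤˣ

/-- The value of the spin at the vertex `i`, as a real number. -/
def spin {N : ℕ} (σ : Spins N) (i : Fin N) : ℝ := ((σ i : ℤ) : ℝ)

/-- The total spin. -/
def totalSpin {N : ℕ} (σ : Spins N) : ℝ := ∑ i, spin σ i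

/-- The sum of `σ_i σ_j` over the edges of the multigraph given by the pairing `π`, counted with
multiplicity (a self-loop is one edge and contributes `1`). Each edge consists of the two half-edges
`h` and `π h`, so that the sum over half-edges counts every edge exactly twice. -/
def edgeSum {N : ℕ} {d : Fin N → ℕ} (π : Equiv.Perm (HalfEdge d)) (σ : Spins N) : ℝ :=
  (∑ h : HalfEdge d, spin σ h.1 * spin σ (π h).1) / 2

/-- The Boltzmann weight of `σ` on the multigraph given by `π`. -/
def boltzmann {N : ℕ} {d : Fin N → ℕ} (β B : ℝ) (π : Equiv.Perm (HalfEdge d)) (σ : Spins N) : ℝ :=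
  Real.exp (β * edgeSum π σ + B * totalSpin σ)

/-- The partition function of the Ising model on the multigraph given by `π`. -/
def partitionFn {N : ℕ} {d : Fin N → ℕ} (β B : ℝ) (π : Equiv.Perm (HalfEdge d)) : ℝ :=
  ∑ σ : Spins N, boltzmann β B π σ

/-- The annealed measure: the mass of the configuration `σ`. -/
def annealedMass {N : ℕ} (d : Fin N → ℕ) (β B : ℝ) (σ : Spins N) : ℝ :=
  graphExpect d (fun π => boltzmann β B π σ) / graphExpect d (partitionFn β B)

/-- The annealed measure of a set of spin configurations. -/
def annealedProb {N : ℕ} (d : Fin N → ℕ) (β B : ℝ) (A : Set (Spins N)) : ℝ :=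
  ∑ σ : Spins N, A.indicator (annealedMass d β B) σ

/-- The annealed pressure in finite volume. -/
def annealedPressure {N : ℕ} (d : Fin N → ℕ) (β B : ℝ) : ℝ :=
  Real.log (graphExpect d (partitionFn β B)) / N

/-- The annealed magnetization in finite volume: the mean of `S_N / N` under the annealed measure. -/
def annealedMagnetization {N : ℕ} (d : Fin N → ℕ) (β B : ℝ) : ℝ :=
  ∑ σ : Spins N, annealedMass d β B σ * (totalSpin σ / N)

/-- Degree sequences of the configuration models `CM_N(1,2)` with parameter `p`: for every `N`,
exactly `⌊pN⌋` of the `N` vertices have degree `2` and the remaining ones have degree `1`. -/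
def IsCM12 (p : ℝ) (d : ∀ N : ℕ, Fin N → ℕ) : Prop :=
  ∀ N, (∀ i, d N i = 1 ∨ d N i = 2) ∧
    (Finset.univ.filter fun i => d N i = 2).card = ⌊p * N⌋₊

/-- `N → ∞` along the sizes for which the total degree is even, i.e. for which the configuration
model with degree sequence `d N` exists. -/
def admissible (d : ∀ N : ℕ, Fin N → ℕ) : Filter ℕ :=
  atTop ⊓ 𝓟 {N | Even (∑ i, d N i)}

end AnnealedIsing

end

/-!
Attach to a half-edge with spin `t` the plane vector `u t = (√(cosh β), t √(sinh β))`, so that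
`⟪u s, u t⟫ = exp (β s t)`. As in Wick's formula, the sum over all perfect matchings of the product
of the inner products of matched vectors equals, up to a constant depending on the number of
vectors, the average over the unit circle of the product of the linear forms they define. The sum
over the spins then factorizes over the vertices, and the annealed partition function becomes
`∫ θ, A θ ^ n₁ * D θ ^ n₂`, with `n₁`, `n₂` the numbers of vertices of degrees one and two. Both
`A ^ 2` and `D` are affine forms in the point `exp (2 i θ)` of the unit circle.

By Laplace's method the pressure is the maximum over the circle of a weighted sum of logarithms of
two affine forms. A critical point at which the gradient points outwards is a global maximum of the
linearization over the disc, which certifies the exponential rate. Comparing the optimality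
certificates of two nearby fields squeezes the pressure between two functions with the same
derivative, so it is differentiable in `B` although nothing is known about how the maximizer depends
on `B`. Since the moment generating function of the total spin is a ratio of partition functions,
Chernoff's bound turns differentiability into exponential concentration at the derivative.
-/

noncomputable section

namespace AnnealedIsing

open Real
open scoped InnerProductSpace

section CircleForm

/-- The real linear form `z ↦ ⟪w, z⟫` on the plane `ℂ`, evaluated along the unit circle. The pair
interactions of the model are inner products, and integrating products of such forms over the
circle performs the sum over matchings. -/
def circleForm (w : ℂ) (θ : ℝ) : ℝ := w.re * cos θ + w.im * sin θ

theorem inner_exp_mul_I (w : ℂ) (θ : ℝ) : ⟪w, Complex.exp (θ * Complex.I)⟫_ℝ = circleForm w θ := by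
  simp only [Complex.inner, circleForm, Complex.mul_re, Complex.conj_re, Complex.conj_im,
    Complex.exp_ofReal_mul_I_re, Complex.exp_ofReal_mul_I_im]
  ring

@[fun_prop]
theorem continuous_circleForm (w : ℂ) : Continuous (circleForm w) := by
  unfold circleForm
  fun_prop

theorem hasDerivAt_circleForm (w : ℂ) (θ : ℝ) :
    HasDerivAt (circleForm w) (circleForm w (θ + π / 2)) θ := by
  refine (((hasDerivAt_cos θ).const_mul w.re).add
    ((hasDerivAt_sin θ).const_mul w.im)).congr_deriv ?_
  rw [circleForm, cos_add_pi_div_two, sin_add_pi_div_two]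

theorem circleForm_add_pi (w : ℂ) (θ : ℝ) : circleForm w (θ + π) = -circleForm w θ := by
  rw [circleForm, circleForm, cos_add_pi, sin_add_pi]
  ring

theorem circleForm_mul_add_circleForm_mul (w z : ℂ) (θ : ℝ) :
    circleForm w θ * circleForm z θ + circleForm w (θ + π / 2) * circleForm z (θ + π / 2) =
      ⟪w, z⟫_ℝ := by
  simp only [circleForm, cos_add_pi_div_two, sin_add_pi_div_two, Complex.inner, Complex.mul_re,
    Complex.conj_re, Complex.conj_im]
  linear_combination (w.re * z.re + w.im * z.im) * sin_sq_add_cos_sq θ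

variable {α : Type*} [DecidableEq α] {S : Finset α} {a : α}

theorem hasDerivAt_circleForm_mul_prod (w : α → ℂ) (ha : a ∈ S) (θ : ℝ) :
    HasDerivAt (fun θ => circleForm (w a) (θ + π / 2) * ∏ i ∈ S.erase a, circleForm (w i) θ)
      (∑ j ∈ S.erase a, ⟪w a, w j⟫_ℝ * ∏ i ∈ (S.erase a).erase j, circleForm (w i) θ -
        S.card * ∏ i ∈ S, circleForm (w i) θ) θ := by
  have hfactor := (hasDerivAt_circleForm (w a) (θ + π / 2)).comp_add_const θ (π / 2)
  rw [add_assoc, add_halves, circleForm_add_pi] at hfactor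
  have hprod := HasDerivAt.fun_finsetProd (u := S.erase a) (f := fun i => circleForm (w i))
    (fun i _ => hasDerivAt_circleForm (w i) θ)
  refine (hfactor.mul hprod).congr_deriv ?_
  have hterm : ∀ j ∈ S.erase a, circleForm (w a) (θ + π / 2) *
      ((∏ i ∈ (S.erase a).erase j, circleForm (w i) θ) * circleForm (w j) (θ + π / 2)) =
      ⟪w a, w j⟫_ℝ * (∏ i ∈ (S.erase a).erase j, circleForm (w i) θ) -
        ∏ i ∈ S, circleForm (w i) θ := by
    intro j hj
    rw [← Finset.mul_prod_erase S _ ha, ← Finset.mul_prod_erase (S.erase a) _ hj,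
      ← circleForm_mul_add_circleForm_mul _ _ θ]
    ring
  simp only [smul_eq_mul, Finset.mul_sum]
  rw [Finset.sum_congr rfl hterm, Finset.sum_sub_distrib, Finset.sum_const, nsmul_eq_mul,
    ← Finset.card_erase_add_one ha, ← Finset.mul_prod_erase S _ ha]
  push_cast
  ring

theorem card_mul_integral_prod_circleForm (w : α → ℂ) (ha : a ∈ S) :
    S.card * ∫ θ in -π..π, ∏ i ∈ S, circleForm (w i) θ =
      ∑ j ∈ S.erase a, ⟪w a, w j⟫_ℝ *
        ∫ θ in -π..π, ∏ i ∈ (S.erase a).erase j, circleForm (w i) θ := by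
  have hftc := intervalIntegral.integral_eq_sub_of_hasDerivAt (a := -π) (b := π)
    (fun θ _ => hasDerivAt_circleForm_mul_prod w ha θ)
    (Continuous.intervalIntegrable (by fun_prop) _ _)
  have hperiodic (v : ℂ) (s : ℝ) : circleForm v (-π + s) = circleForm v (π + s) := by
    rw [neg_add_eq_sub, add_comm π, circleForm, circleForm, cos_sub_pi, sin_sub_pi, cos_add_pi,
      sin_add_pi]
  have hperiodic_zero (v : ℂ) : circleForm v (-π) = circleForm v π := by
    simpa only [add_zero] using hperiodic v 0
  simp only [hperiodic, hperiodic_zero, sub_self] at hftc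
  rw [intervalIntegral.integral_sub (Continuous.intervalIntegrable (by fun_prop) _ _)
    (Continuous.intervalIntegrable (by fun_prop) _ _), intervalIntegral.integral_finsetSum
    fun _ _ => Continuous.intervalIntegrable (by fun_prop) _ _] at hftc
  simp only [intervalIntegral.integral_const_mul] at hftc
  exact (sub_eq_zero.1 hftc).symm

end CircleForm

section Matchings

open Equiv
open scoped Nat

variable {α : Type*} [Fintype α] [DecidableEq α] {S : Finset α} {a j : α} {τ : Perm α}

/-- The perfect matchings of `S`, encoded as the involutions of the whole type whose support
is `S`. -/
def matchings (S : Finset α) : Finset (Perm α) :=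
  {τ | τ * τ = 1 ∧ τ.support = S}

theorem mem_matchings : τ ∈ matchings S ↔ τ * τ = 1 ∧ τ.support = S := by
  simp only [matchings, Finset.mem_filter, Finset.mem_univ, true_and]

theorem matchings_empty : matchings (∅ : Finset α) = {1} := by
  ext τ
  simp +contextual [mem_matchings]

theorem swap_mul_mem_matchings (ha : a ∈ S) (hj : j ∈ S.erase a)
    (hτ : τ ∈ matchings ((S.erase a).erase j)) :
    swap a j * τ ∈ matchings S ∧ (swap a j * τ) a = j := by
  rw [mem_matchings] at hτ ⊢
  obtain ⟨hinv, hsupp⟩ := hτ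
  obtain ⟨hja, hjS⟩ := Finset.mem_erase.1 hj
  have hdisj : (swap a j).Disjoint τ := by
    rw [Perm.disjoint_iff_disjoint_support, hsupp, Perm.support_swap hja.symm]
    simp [Finset.disjoint_left]
  have haτ : τ a = a := by
    rw [← Perm.notMem_support, hsupp]
    simp
  refine ⟨⟨?_, ?_⟩, by rw [Perm.mul_apply, haτ, swap_apply_left]⟩
  · rw [mul_assoc, ← mul_assoc τ, ← hdisj.commute.eq, mul_assoc (swap a j) τ, hinv, mul_one,
      swap_mul_self]
  · rw [hdisj.support_mul, hsupp, Perm.support_swap hja.symm]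
    ext x
    simp only [Finset.mem_union, Finset.mem_insert, Finset.mem_singleton, Finset.mem_erase]
    grind

theorem swap_mul_mem_matchings_erase (hτ : τ ∈ matchings S) (ha : a ∈ S) :
    swap a (τ a) * τ ∈ matchings ((S.erase a).erase (τ a)) := by
  rw [mem_matchings] at hτ ⊢
  obtain ⟨hinv, rfl⟩ := hτ
  have happly : ∀ x, τ (τ x) = x := fun x => by rw [← Perm.mul_apply, hinv, Perm.one_apply]
  have hcomm : τ * swap a (τ a) = swap a (τ a) * τ := by
    rw [mul_swap_eq_swap_mul, happly, swap_comm]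
  refine ⟨?_, ?_⟩
  · rw [mul_assoc, ← mul_assoc τ, hcomm, mul_assoc, hinv, mul_one, swap_mul_self]
  · ext x
    simp only [Perm.mem_support, Perm.mul_apply, Finset.mem_erase] at ha ⊢
    rcases eq_or_ne x a with rfl | hxa
    · simp
    rcases eq_or_ne x (τ a) with rfl | hxτ
    · simp [happly]
    rw [swap_apply_of_ne_of_ne (fun h => hxτ (by rw [← h, happly])) (τ.injective.ne hxa)]
    simp [hxa, hxτ]

/-- A matching of `S` is determined by the partner `j` of `a` and a matching of the rest. -/
theorem sum_matchings_prod {R : Type*} [CommSemiring R] (g : α → α → R) (ha : a ∈ S) :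
    ∑ τ ∈ matchings S, ∏ h ∈ S, g h (τ h) =
      ∑ j ∈ S.erase a, g a j * g j a *
        ∑ τ ∈ matchings ((S.erase a).erase j), ∏ h ∈ (S.erase a).erase j, g h (τ h) := by
  have hmaps : ∀ τ ∈ matchings S, τ a ∈ S.erase a := by
    intro τ hτ
    obtain ⟨-, rfl⟩ := mem_matchings.1 hτ
    exact Finset.mem_erase.2 ⟨Perm.mem_support.1 ha, Perm.apply_mem_support.2 ha⟩
  rw [← Finset.sum_fiberwise_of_maps_to hmaps]
  refine Finset.sum_congr rfl fun j hj => ?_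
  rw [Finset.mul_sum]
  symm
  refine Finset.sum_nbij' (swap a j * ·) (swap a j * ·) (fun τ hτ => ?_) (fun τ hτ => ?_)
    (fun τ _ => swap_mul_self_mul _ _ _) (fun τ _ => swap_mul_self_mul _ _ _) fun τ hτ => ?_
  · exact Finset.mem_filter.2 (swap_mul_mem_matchings ha hj hτ)
  · obtain ⟨hτS, rfl⟩ := Finset.mem_filter.1 hτ
    exact swap_mul_mem_matchings_erase hτS ha
  · rw [← Finset.mul_prod_erase S _ ha, ← Finset.mul_prod_erase (S.erase a) _ hj, ← mul_assoc]
    have hfix : ∀ x ∉ (S.erase a).erase j, τ x = x := by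
      intro x hx
      rwa [← Perm.notMem_support, (mem_matchings.1 hτ).2]
    simp only [Perm.mul_apply]
    rw [hfix a (by simp), hfix j (by simp), swap_apply_left, swap_apply_right]
    congr 1
    refine Finset.prod_congr rfl fun x hx => ?_
    rw [← (mem_matchings.1 hτ).2] at hx hfix
    have hmem := Perm.apply_mem_support.2 hx
    rw [swap_apply_of_ne_of_ne] <;> rintro rfl <;> simp [(mem_matchings.1 hτ).2] at hmem

theorem sum_matchings_prod_eq_integral {g : α → α → ℝ} {w : α → ℂ}
    (hw : ∀ x y, ⟪w x, w y⟫_ℝ = g x y * g y x) (S : Finset α) :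
    ∑ τ ∈ matchings S, ∏ h ∈ S, g h (τ h) =
      S.card‼ / (2 * π) * ∫ θ in -π..π, ∏ i ∈ S, circleForm (w i) θ := by
  induction S using Finset.strongInduction with
  | H S ih =>
    obtain rfl | ⟨a, ha⟩ := S.eq_empty_or_nonempty
    · have := pi_ne_zero
      simp only [matchings_empty, Finset.prod_empty, Finset.sum_singleton, Finset.card_empty,
        intervalIntegral.integral_const, smul_eq_mul, Nat.doubleFactorial]
      field_simp
      norm_num
    rw [sum_matchings_prod g ha]
    have hterm : ∀ j ∈ S.erase a, g a j * g j a *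
        ∑ τ ∈ matchings ((S.erase a).erase j), ∏ h ∈ (S.erase a).erase j, g h (τ h) =
        (S.card - 2)‼ / (2 * π) * (⟪w a, w j⟫_ℝ *
          ∫ θ in -π..π, ∏ i ∈ (S.erase a).erase j, circleForm (w i) θ) := by
      intro j hj
      rw [ih _ ((Finset.erase_ssubset hj).trans (Finset.erase_ssubset ha)), hw,
        Finset.card_erase_of_mem hj, Finset.card_erase_of_mem ha, Nat.sub_sub]
      ring
    rw [Finset.sum_congr rfl hterm, ← Finset.mul_sum, ← card_mul_integral_prod_circleForm w ha]
    have hcard : S.card‼ = S.card * (S.card - 2)‼ := by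
      rw [← Finset.card_erase_add_one ha, Nat.doubleFactorial_add_one, Nat.add_sub_add_right]
    rw [hcard]
    push_cast
    ring

end Matchings

section PartitionFunction

open scoped Nat

variable {N : ℕ} (d : Fin N → ℕ) {β : ℝ} (B : ℝ)

/-- The vector in the plane attached to a half-edge with spin `t`, chosen so that the inner products
of these vectors are the edge weights `exp (β s t)`. It exists only for ferromagnetic `β`: for
`β < 0` the junk value `√(sinh β) = 0` breaks this. -/
def spinVector (β : ℝ) (t : ℤˣ) : ℂ := ⟨√(cosh β), (t : ℤ) * √(sinh β)⟩

/-- The total weight of a vertex of degree `k` in the direction `θ`: its spin has been summed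
over. -/
def vertexWeight (β B : ℝ) (k : ℕ) (θ : ℝ) : ℝ :=
  ∑ t : ℤˣ, exp (B * (t : ℤ)) * circleForm (spinVector β t) θ ^ k

/-- The circle integral which, up to normalization, is the annealed partition function of the
configuration model with degree sequence `d`. -/
def weightIntegral (β B : ℝ) : ℝ := ∫ θ in -π..π, ∏ i, vertexWeight β B (d i) θ

theorem pairings_eq_matchings : pairings d = matchings Finset.univ := by
  ext τ
  simp only [pairings, mem_matchings, Finset.mem_filter, Finset.mem_univ, true_and, Equiv.ext_iff,
    Equiv.Perm.mul_apply, Equiv.Perm.one_apply, Finset.ext_iff, Equiv.Perm.mem_support, iff_true]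

theorem inner_spinVector (hβ : 0 ≤ β) (s t : ℤˣ) :
    ⟪spinVector β s, spinVector β t⟫_ℝ = exp (β * ((s : ℤ) * (t : ℤ))) := by
  have hcosh : √(cosh β) * √(cosh β) = cosh β := mul_self_sqrt (cosh_pos β).le
  have hsinh : √(sinh β) * √(sinh β) = sinh β := mul_self_sqrt (sinh_nonneg_iff.2 hβ)
  have hinner : ⟪spinVector β s, spinVector β t⟫_ℝ = cosh β + ((s : ℤ) * (t : ℤ)) * sinh β := by
    simp only [spinVector, Complex.inner, Complex.mul_re, Complex.conj_re, Complex.conj_im]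
    linear_combination hcosh + ((s : ℤ) : ℝ) * (t : ℤ) * hsinh
  rw [hinner]
  rcases Int.units_eq_one_or s with rfl | rfl <;> rcases Int.units_eq_one_or t with rfl | rfl <;>
    simp [cosh_add_sinh, cosh_sub_sinh, ← sub_eq_add_neg]

theorem boltzmann_eq_mul_prod (τ : Equiv.Perm (HalfEdge d)) (σ : Spins N) :
    boltzmann β B τ σ =
      exp (B * totalSpin σ) * ∏ h, exp (β / 2 * (spin σ h.1 * spin σ (τ h).1)) := by
  rw [boltzmann, edgeSum, ← exp_sum, ← Finset.mul_sum, ← exp_add]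
  ring_nf

theorem sum_boltzmann (hβ : 0 ≤ β) (σ : Spins N) :
    ∑ τ ∈ pairings d, boltzmann β B τ σ = (∑ i, d i)‼ / (2 * π) *
      ∫ θ in -π..π, ∏ i, exp (B * spin σ i) * circleForm (spinVector β (σ i)) θ ^ d i := by
  have hmatch := sum_matchings_prod_eq_integral
    (g := fun x y : HalfEdge d => exp (β / 2 * (spin σ x.1 * spin σ y.1)))
    (w := fun x => spinVector β (σ x.1))
    (fun x y => by rw [inner_spinVector hβ, ← exp_add, spin, spin]; ring_nf) Finset.univ
  have hcard : (Finset.univ : Finset (HalfEdge d)).card = ∑ i, d i := by simp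
  have hprod (θ : ℝ) : ∏ i, exp (B * spin σ i) * circleForm (spinVector β (σ i)) θ ^ d i =
      exp (B * totalSpin σ) * ∏ h : HalfEdge d, circleForm (spinVector β (σ h.1)) θ := by
    rw [Finset.prod_mul_distrib, ← exp_sum, ← Finset.mul_sum, totalSpin, Fintype.prod_sigma]
    simp only [Finset.prod_const, Finset.card_univ, Fintype.card_fin]
  simp only [boltzmann_eq_mul_prod, ← Finset.mul_sum, hprod, intervalIntegral.integral_const_mul]
  rw [pairings_eq_matchings, hmatch, hcard, mul_left_comm]

theorem sum_partitionFn (hβ : 0 ≤ β) :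
    ∑ τ ∈ pairings d, partitionFn β B τ = (∑ i, d i)‼ / (2 * π) * weightIntegral d β B := by
  have hspins (θ : ℝ) : ∏ i, vertexWeight β B (d i) θ = ∑ σ : Spins N,
      ∏ i, exp (B * spin σ i) * circleForm (spinVector β (σ i)) θ ^ d i := by
    simp only [vertexWeight, spin, Finset.prod_univ_sum, Fintype.piFinset_univ]
  simp only [partitionFn, weightIntegral, hspins]
  rw [Finset.sum_comm, intervalIntegral.integral_finsetSum
    fun _ _ => Continuous.intervalIntegrable (by fun_prop) _ _, Finset.mul_sum]
  exact Finset.sum_congr rfl fun σ _ => sum_boltzmann d B hβ σ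

/-- At `β = B = 0` every configuration has weight one, so that the normalizing constant is itself
a weight integral. -/
theorem graphExpect_partitionFn (hβ : 0 ≤ β) :
    graphExpect d (partitionFn β B) = 2 ^ N * (weightIntegral d β B / weightIntegral d 0 0) := by
  have hfactor : ((∑ i, d i)‼ : ℝ) / (2 * π) ≠ 0 :=
    div_ne_zero (Nat.cast_ne_zero.2 (Nat.doubleFactorial_pos _).ne') (by positivity)
  have hcard : ((pairings d).card : ℝ) * 2 ^ N = (∑ i, d i)‼ / (2 * π) * weightIntegral d 0 0 := by
    rw [← sum_partitionFn d 0 le_rfl]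
    simp [partitionFn, boltzmann]
  rw [graphExpect, sum_partitionFn d B hβ, ← mul_div_mul_left (weightIntegral d β B) _ hfactor,
    ← hcard, mul_div_assoc', mul_comm ((pairings d).card : ℝ), mul_div_mul_left _ _ (by positivity)]

end PartitionFunction

theorem hasDerivAt_of_squeeze {l f u : ℝ → ℝ} {l' x : ℝ} (hl : HasDerivAt l l' x)
    (hu : DifferentiableAt ℝ u x) (hlf : ∀ᶠ y in 𝓝 x, l y ≤ f y) (hfu : ∀ᶠ y in 𝓝 x, f y ≤ u y)
    (hx : u x = l x) : HasDerivAt f l' x := by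
  have hgap := hu.hasDerivAt.sub hl
  have hmin : IsLocalMin (u - l) x := by
    filter_upwards [hlf, hfu] with y hly hyu
    rw [Pi.sub_apply, Pi.sub_apply, hx, sub_self]
    exact sub_nonneg.2 (hly.trans hyu)
  rw [hmin.hasDerivAt_eq_zero hgap] at hgap
  have hsmall : (fun y => f y - l y) =o[𝓝 x] fun y => y - x := by
    refine Asymptotics.IsBigO.trans_isLittleO (.of_bound 1 ?_) (hasDerivAt_iff_isLittleO.1 hgap)
    filter_upwards [hlf, hfu] with y hly hyu
    simp only [Pi.sub_apply, hx, sub_self, smul_zero, sub_zero, one_mul, norm_eq_abs]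
    rw [abs_of_nonneg (sub_nonneg.2 hly), abs_of_nonneg (sub_nonneg.2 (hly.trans hyu))]
    exact sub_le_sub_right hyu _
  have hfx : f x = l x := le_antisymm (hx ▸ hfu.self_of_nhds) hlf.self_of_nhds
  rw [hasDerivAt_iff_isLittleO] at hl ⊢
  refine (hsmall.add hl).congr_left fun y => ?_
  rw [hfx]
  ring

section AffineForms

variable {ι E : Type*} [Fintype ι] [NormedAddCommGroup E] [InnerProductSpace ℝ E]
  {c : ι → ℝ} {Q Q' : ι → ℝ × E} {z z' : E}

/-- The affine form `z ↦ a + ⟪v, z⟫`, encoded by the pair `(a, v)`. -/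
def affineForm (q : ℝ × E) (z : E) : ℝ := q.1 + ⟪q.2, z⟫_ℝ

/-- The logarithm of the product of the affine forms `Q i`, raised to the powers `c i`. -/
def logProd (c : ι → ℝ) (Q : ι → ℝ × E) (z : E) : ℝ := ∑ i, c i * log (affineForm (Q i) z)

/-- The affine form obtained from `Q'` by linearizing `logProd c` at the forms `Q` and the
point `z`. -/
def tangentForm (c : ι → ℝ) (Q : ι → ℝ × E) (z : E) (Q' : ι → ℝ × E) : ℝ × E :=
  ∑ i, (c i / affineForm (Q i) z) • Q' i

/-- A point of the unit sphere at which `logProd c Q` is defined and has an outward normal gradient.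
Since `logProd c Q` is concave, such a point maximizes it over the unit ball. -/
structure IsOptimal (c : ι → ℝ) (Q : ι → ℝ × E) (z : E) : Prop where
  norm_eq_one : ‖z‖ = 1
  pos : ∀ i, 0 < affineForm (Q i) z
  exists_smul_eq : ∃ ρ : ℝ, 0 < ρ ∧ (tangentForm c Q z Q).2 = ρ • z

theorem affineForm_le (q : ℝ × E) (hz : ‖z‖ ≤ 1) : affineForm q z ≤ q.1 + ‖q.2‖ :=
  add_le_add_right ((real_inner_le_norm _ _).trans (mul_le_of_le_one_right (norm_nonneg _) hz)) _

@[fun_prop]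
theorem continuous_affineForm (q : ℝ × E) : Continuous (affineForm q) := by
  unfold affineForm
  fun_prop

theorem affineForm_sum_smul {κ : Type*} (s : Finset κ) (a : κ → ℝ) (q : κ → ℝ × E) (z : E) :
    affineForm (∑ k ∈ s, a k • q k) z = ∑ k ∈ s, a k * affineForm (q k) z := by
  simp only [affineForm, Prod.fst_sum, Prod.snd_sum, Prod.smul_fst, Prod.smul_snd, sum_inner,
    real_inner_smul_left, smul_eq_mul, mul_add, Finset.sum_add_distrib]

theorem affineForm_tangentForm (z' : E) :
    affineForm (tangentForm c Q z Q') z' =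
      ∑ i, c i * (affineForm (Q' i) z' / affineForm (Q i) z) := by
  simp only [tangentForm, affineForm_sum_smul, mul_div_assoc', div_mul_eq_mul_div]

theorem continuousOn_snd_tangentForm {X : Type*} [TopologicalSpace X] {f : X → E} {s : Set X}
    (hf : ContinuousOn f s) (hpos : ∀ x ∈ s, ∀ i, 0 < affineForm (Q i) (f x)) :
    ContinuousOn (fun x => (tangentForm c Q (f x) Q').2) s := by
  simp only [tangentForm, Prod.snd_sum, Prod.smul_snd]
  exact continuousOn_finsetSum _ fun i _ => (continuousOn_const.div
    ((continuous_affineForm (Q i)).comp_continuousOn hf) fun x hx => (hpos x hx i).ne').smul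
      continuousOn_const

theorem logProd_le (hc : ∀ i, 0 ≤ c i) (hQ : ∀ i, 0 < affineForm (Q i) z)
    (hQ' : ∀ i, 0 < affineForm (Q' i) z') :
    logProd c Q' z' ≤ logProd c Q z + (affineForm (tangentForm c Q z Q') z' - ∑ i, c i) := by
  rw [affineForm_tangentForm, logProd, logProd, ← Finset.sum_sub_distrib, ← Finset.sum_add_distrib]
  refine Finset.sum_le_sum fun i _ => ?_
  have hlog := log_le_sub_one_of_pos (div_pos (hQ' i) (hQ i))
  rw [log_div (hQ' i).ne' (hQ i).ne'] at hlog
  linarith [mul_le_mul_of_nonneg_left hlog (hc i)]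

theorem IsOptimal.fst_add_norm_snd_tangentForm (h : IsOptimal c Q z) :
    (tangentForm c Q z Q).1 + ‖(tangentForm c Q z Q).2‖ = ∑ i, c i := by
  obtain ⟨ρ, hρ, hgrad⟩ := h.exists_smul_eq
  have hinner : ⟪(tangentForm c Q z Q).2, z⟫_ℝ = ‖(tangentForm c Q z Q).2‖ := by
    rw [hgrad, real_inner_smul_left, real_inner_self_eq_norm_sq, norm_smul, h.norm_eq_one, one_pow,
      norm_of_nonneg hρ.le]
  rw [← hinner, ← affineForm, affineForm_tangentForm]
  exact Finset.sum_congr rfl fun i _ => by rw [div_self (h.pos i).ne', mul_one]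

theorem IsOptimal.affineForm_tangentForm_le (h : IsOptimal c Q z) (hz' : ‖z'‖ ≤ 1) :
    affineForm (tangentForm c Q z Q) z' ≤ ∑ i, c i :=
  (affineForm_le _ hz').trans_eq h.fst_add_norm_snd_tangentForm

theorem IsOptimal.logProd_le (h : IsOptimal c Q z) (hc : ∀ i, 0 ≤ c i) (hz' : ‖z'‖ ≤ 1)
    (hpos : ∀ i, 0 < affineForm (Q i) z') : logProd c Q z' ≤ logProd c Q z := by
  linarith [AnnealedIsing.logProd_le hc h.pos hpos, h.affineForm_tangentForm_le hz']

theorem hasDerivAt_tangentForm {F : ℝ → ι → ℝ × E} {b : ℝ} (hF : HasDerivAt F Q' b) :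
    HasDerivAt (fun b => tangentForm c Q z (F b)) (tangentForm c Q z Q') b := by
  rw [hasDerivAt_pi] at hF
  exact HasDerivAt.fun_sum fun i _ => (hF i).fun_const_smul _

theorem hasDerivAt_affineForm {F : ℝ → ℝ × E} {F' : ℝ × E} {b : ℝ} (hF : HasDerivAt F F' b) :
    HasDerivAt (fun b => affineForm (F b) z) (affineForm F' z) b := by
  have hfst := (ContinuousLinearMap.fst ℝ ℝ E).hasFDerivAt.comp_hasDerivAt b hF
  have hsnd := (ContinuousLinearMap.snd ℝ ℝ E).hasFDerivAt.comp_hasDerivAt b hF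
  refine (hfst.add (hsnd.inner ℝ (hasDerivAt_const b z))).congr_deriv ?_
  rw [inner_zero_right, zero_add]
  rfl

theorem hasDerivAt_logProd {F : ℝ → ι → ℝ × E} {b : ℝ} (hF : HasDerivAt F Q' b)
    (hpos : ∀ i, 0 < affineForm (F b i) z) :
    HasDerivAt (fun b => logProd c (F b) z) (affineForm (tangentForm c (F b) z Q') z) b := by
  rw [hasDerivAt_pi] at hF
  rw [affineForm_tangentForm]
  exact HasDerivAt.fun_sum fun i _ =>
    ((hasDerivAt_affineForm (hF i)).log (hpos i).ne').const_mul (c i)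

/-- The envelope theorem, without any regularity of the maximizer `z b`: freezing the maximizer at
`b₀` gives a lower bound for the maximum, linearizing the logarithms at `b₀` and maximizing the
resulting affine form over the unit ball gives an upper bound, and both touch it at `b₀`. -/
theorem hasDerivAt_logProd_of_isOptimal {F : ℝ → ι → ℝ × E} {z : ℝ → E} {b₀ : ℝ}
    (hc : ∀ i, 0 ≤ c i) (hF : HasDerivAt F Q' b₀) (hz : ∀ b, IsOptimal c (F b) (z b)) :
    HasDerivAt (fun b => logProd c (F b) (z b))
      (affineForm (tangentForm c (F b₀) (z b₀) Q') (z b₀)) b₀ := by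
  set T : ℝ → ℝ × E := fun b => tangentForm c (F b₀) (z b₀) (F b)
  have hT : HasDerivAt T (tangentForm c (F b₀) (z b₀) Q') b₀ := hasDerivAt_tangentForm hF
  have hgrad : (T b₀).2 ≠ 0 := by
    obtain ⟨ρ, hρ, hρz⟩ := (hz b₀).exists_smul_eq
    rw [hρz]
    exact smul_ne_zero hρ.ne' (norm_ne_zero_iff.1 (by simp [(hz b₀).norm_eq_one]))
  have hupper : DifferentiableAt ℝ
      (fun b => logProd c (F b₀) (z b₀) + ((T b).1 + ‖(T b).2‖ - ∑ i, c i)) b₀ :=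
    ((hT.differentiableAt.fst.add (hT.differentiableAt.snd.norm ℝ hgrad)).sub_const _).const_add _
  have hpos : ∀ᶠ b in 𝓝 b₀, ∀ i, 0 < affineForm (F b i) (z b₀) :=
    eventually_all.2 fun i => (hasDerivAt_affineForm (hasDerivAt_pi.1 hF i)).continuousAt.eventually
      (lt_mem_nhds ((hz b₀).pos i))
  refine hasDerivAt_of_squeeze (hasDerivAt_logProd hF (hz b₀).pos) hupper ?_
    (.of_forall fun b => ?_) ?_
  · filter_upwards [hpos] with b hb
    exact (hz b).logProd_le hc (hz b₀).norm_eq_one.le hb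
  · have := affineForm_le (T b) (hz b).norm_eq_one.le
    linarith [logProd_le hc (hz b₀).pos (hz b).pos]
  · rw [(hz b₀).fst_add_norm_snd_tangentForm, sub_self, add_zero]

end AffineForms

section PlaneOptimum

theorem affineForm_pos {q : ℝ × ℂ} {z : ℂ} (hq : ‖q.2‖ ≤ q.1) (hre : 0 < q.2.re) (hz : ‖z‖ ≤ 1)
    (hzre : 0 ≤ z.re) : 0 < affineForm q z := by
  have him : |q.2.im * z.im| < q.1 := calc
    |q.2.im * z.im| = |q.2.im| * |z.im| := abs_mul _ _
    _ ≤ |q.2.im| := mul_le_of_le_one_right (abs_nonneg _) ((Complex.abs_im_le_norm z).trans hz)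
    _ < ‖q.2‖ := Complex.abs_im_lt_norm.2 hre.ne'
    _ ≤ q.1 := hq
  have hinner : ⟪q.2, z⟫_ℝ = q.2.re * z.re + q.2.im * z.im := by
    simp only [Complex.inner, Complex.mul_re, Complex.conj_re, Complex.conj_im]
    ring
  rw [affineForm, hinner]
  linarith [mul_nonneg hre.le hzre, (abs_lt.1 him).1]

theorem exists_pos_smul_exp_eq {g : ℂ} {φ : ℝ} (htangent : circleForm g (φ + π / 2) = 0)
    (hre : 0 < g.re) (hcos : 0 ≤ cos φ) :
    ∃ ρ : ℝ, 0 < ρ ∧ g = ρ • Complex.exp (φ * Complex.I) := by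
  rw [circleForm, cos_add_pi_div_two, sin_add_pi_div_two] at htangent
  have hre_eq : circleForm g φ * cos φ = g.re := by
    rw [circleForm]
    linear_combination g.re * sin_sq_add_cos_sq φ + sin φ * htangent
  refine ⟨circleForm g φ, pos_of_mul_pos_left (hre_eq ▸ hre) hcos, Complex.ext ?_ ?_⟩
  · rw [Complex.smul_re, Complex.exp_ofReal_mul_I_re, smul_eq_mul, hre_eq]
  · rw [Complex.smul_im, Complex.exp_ofReal_mul_I_im, smul_eq_mul, circleForm]
    linear_combination -g.im * sin_sq_add_cos_sq φ + cos φ * htangent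

variable {ι : Type*} [Fintype ι] {c : ι → ℝ} {Q : ι → ℝ × ℂ}

theorem re_snd_tangentForm_pos {z : ℂ} (hc : ∀ i, 0 ≤ c i) (hc_pos : ∃ i, 0 < c i)
    (hpos : ∀ i, 0 < affineForm (Q i) z) (hre : ∀ i, 0 < (Q i).2.re) :
    0 < (tangentForm c Q z Q).2.re := by
  obtain ⟨j, hj⟩ := hc_pos
  simp only [tangentForm, Prod.snd_sum, Complex.re_sum, Prod.smul_snd, Complex.smul_re, smul_eq_mul]
  exact Finset.sum_pos' (fun i _ => mul_nonneg (div_nonneg (hc i) (hpos i).le) (hre i).le)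
    ⟨j, Finset.mem_univ j, mul_pos (div_pos hj (hpos j)) (hre j)⟩

/-- The tangential component of the gradient of `logProd c Q` points inwards at both ends of the
right half of the unit circle, hence vanishes somewhere in between. -/
theorem exists_isOptimal (hc : ∀ i, 0 ≤ c i) (hc_pos : ∃ i, 0 < c i)
    (hnorm : ∀ i, ‖(Q i).2‖ ≤ (Q i).1) (hre : ∀ i, 0 < (Q i).2.re) :
    ∃ φ ∈ Set.Icc (-(π / 2)) (π / 2), IsOptimal c Q (Complex.exp (φ * Complex.I)) := by
  set I : Set ℝ := Set.Icc (-(π / 2)) (π / 2)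
  set z : ℝ → ℂ := fun φ => Complex.exp (φ * Complex.I)
  set g : ℝ → ℂ := fun φ => (tangentForm c Q (z φ) Q).2
  have hcos : ∀ φ ∈ I, 0 ≤ cos φ := fun φ => cos_nonneg_of_mem_Icc
  have hz : ∀ φ, ‖z φ‖ = 1 := Complex.norm_exp_ofReal_mul_I
  have hpos : ∀ φ ∈ I, ∀ i, 0 < affineForm (Q i) (z φ) := fun φ hφ i =>
    affineForm_pos (hnorm i) (hre i) (hz φ).le
      ((hcos φ hφ).trans_eq (Complex.exp_ofReal_mul_I_re φ).symm)
  have hgre : ∀ φ ∈ I, 0 < (g φ).re := fun φ hφ =>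
    re_snd_tangentForm_pos hc hc_pos (hpos φ hφ) hre
  have hg : ContinuousOn g I := continuousOn_snd_tangentForm (by fun_prop) hpos
  have htangent : ContinuousOn (fun φ => circleForm (g φ) (φ + π / 2)) I := by
    unfold circleForm
    fun_prop
  have hends : -(π / 2) ≤ π / 2 := by linarith [pi_pos]
  have hleft : 0 ≤ circleForm (g (-(π / 2))) (-(π / 2) + π / 2) := by
    simpa [circleForm] using (hgre _ (Set.left_mem_Icc.2 hends)).le
  have hright : circleForm (g (π / 2)) (π / 2 + π / 2) ≤ 0 := by
    simpa [circleForm] using (hgre _ (Set.right_mem_Icc.2 hends)).le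
  obtain ⟨φ, hφ, hzero⟩ := intermediate_value_Icc' hends htangent ⟨hright, hleft⟩
  exact ⟨φ, hφ, hz φ, hpos φ hφ, exists_pos_smul_exp_eq hzero (hgre φ hφ) (hcos φ hφ)⟩

end PlaneOptimum

section WeightForms

/-- The affine form on the plane that represents `circleForm w θ ^ 2` as a function of the unit
vector in the direction `2 * θ`. -/
def squareForm (w : ℂ) : ℝ × ℂ := (‖w‖ ^ 2 / 2, w ^ 2 / 2)

/-- The affine forms representing, as functions of the unit vector in the direction `2 * θ`, the
square of the weight of a vertex of degree one and the weight of a vertex of degree two. -/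
def weightForm (β B : ℝ) : Fin 2 → ℝ × ℂ :=
  ![squareForm (∑ t : ℤˣ, exp (B * (t : ℤ)) • spinVector β t),
    ∑ t : ℤˣ, exp (B * (t : ℤ)) • squareForm (spinVector β t)]

/-- The exponents, per vertex, of the two forms of `weightForm` in the integrand of
`weightIntegral`. -/
def exponentRate (p : ℝ) : Fin 2 → ℝ := ![(1 - p) / 2, p]

theorem affineForm_squareForm (w : ℂ) (θ : ℝ) :
    affineForm (squareForm w) (Complex.exp ((2 * θ : ℝ) * Complex.I)) = circleForm w θ ^ 2 := by
  have hre : (w ^ 2 / 2).re = (w.re ^ 2 - w.im ^ 2) / 2 := by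
    rw [Complex.div_ofNat_re, sq, Complex.mul_re]
    ring
  have him : (w ^ 2 / 2).im = w.re * w.im := by
    rw [Complex.div_ofNat_im, sq, Complex.mul_im]
    ring
  simp only [affineForm, squareForm, inner_exp_mul_I]
  rw [circleForm, circleForm, hre, him, Complex.sq_norm, Complex.normSq_apply, cos_two_mul,
    sin_two_mul]
  linear_combination -w.im ^ 2 * sin_sq_add_cos_sq θ

theorem vertexWeight_one_sq (β B θ : ℝ) : vertexWeight β B 1 θ ^ 2 =
    affineForm (weightForm β B 0) (Complex.exp ((2 * θ : ℝ) * Complex.I)) := by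
  simp only [weightForm, Matrix.cons_val_zero, affineForm_squareForm, vertexWeight, pow_one,
    ← inner_exp_mul_I, sum_inner, real_inner_smul_left]

theorem vertexWeight_two (β B θ : ℝ) : vertexWeight β B 2 θ =
    affineForm (weightForm β B 1) (Complex.exp ((2 * θ : ℝ) * Complex.I)) := by
  simp only [weightForm, Matrix.cons_val_one, Matrix.cons_val_fin_one, affineForm_sum_smul,
    affineForm_squareForm, vertexWeight]

theorem norm_snd_squareForm (w : ℂ) : ‖(squareForm w).2‖ = (squareForm w).1 := by
  simp [squareForm]

theorem norm_snd_weightForm_le (β B : ℝ) (i : Fin 2) :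
    ‖(weightForm β B i).2‖ ≤ (weightForm β B i).1 := by
  revert i
  refine Fin.forall_fin_two.2 ⟨(norm_snd_squareForm _).le, ?_⟩
  simp only [weightForm, Matrix.cons_val_one, Matrix.cons_val_fin_one, Prod.fst_sum, Prod.snd_sum,
    Prod.smul_fst, Prod.smul_snd]
  refine norm_sum_le_of_le _ fun t _ => ?_
  rw [norm_smul, norm_snd_squareForm, norm_of_nonneg (exp_pos _).le, smul_eq_mul]

theorem re_snd_squareForm_pos {w : ℂ} (hw : |w.im| < w.re) : 0 < (squareForm w).2.re := by
  rw [squareForm, Complex.div_ofNat_re, sq, Complex.mul_re, ← sq, ← sq]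
  exact half_pos (sub_pos.2 (sq_lt_sq.2 (hw.trans_le (le_abs_self _))))

theorem abs_im_spinVector_lt_re (β : ℝ) (t : ℤˣ) : |(spinVector β t).im| < (spinVector β t).re := by
  have habs : |((t : ℤ) : ℝ)| = 1 := by rcases Int.units_eq_one_or t with rfl | rfl <;> simp
  simp only [spinVector, abs_mul, habs, one_mul, abs_of_nonneg (sqrt_nonneg _)]
  exact (sqrt_lt_sqrt_iff_of_pos (cosh_pos β)).2 (sinh_lt_cosh β)

theorem re_snd_weightForm_pos (β B : ℝ) (i : Fin 2) : 0 < (weightForm β B i).2.re := by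
  revert i
  refine Fin.forall_fin_two.2 ⟨re_snd_squareForm_pos ?_, ?_⟩
  · simp only [Complex.re_sum, Complex.im_sum, Complex.smul_re, Complex.smul_im, smul_eq_mul]
    refine (Finset.abs_sum_le_sum_abs _ _).trans_lt
      (Finset.sum_lt_sum_of_nonempty Finset.univ_nonempty fun t _ => ?_)
    rw [abs_mul, abs_of_pos (exp_pos _)]
    exact mul_lt_mul_of_pos_left (abs_im_spinVector_lt_re β t) (exp_pos _)
  · simp only [weightForm, Matrix.cons_val_one, Matrix.cons_val_fin_one, Prod.snd_sum,
      Prod.smul_snd, Complex.re_sum, Complex.smul_re, smul_eq_mul]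
    exact Finset.sum_pos (fun t _ => mul_pos (exp_pos _)
      (re_snd_squareForm_pos (abs_im_spinVector_lt_re β t))) Finset.univ_nonempty

theorem differentiable_weightForm (β : ℝ) : Differentiable ℝ (weightForm β) := by
  refine differentiable_pi.2 (Fin.forall_fin_two.2 ⟨?_, ?_⟩)
  · have hsum : Differentiable ℝ fun B => ∑ t : ℤˣ, exp (B * (t : ℤ)) • spinVector β t := by
      fun_prop
    exact (hsum.norm_sq ℝ |>.div_const 2).prodMk ((hsum.pow 2).div_const 2)
  · simp only [weightForm, Matrix.cons_val_one, Matrix.cons_val_fin_one]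
    fun_prop

theorem spinVector_zero (t : ℤˣ) : spinVector 0 t = 1 := by
  apply Complex.ext <;> simp [spinVector]

theorem weightForm_zero_zero : weightForm 0 0 = ![(2, 2), (1, 1)] := by
  norm_num [weightForm, squareForm, spinVector_zero, Finset.sum_const]

theorem exponentRate_nonneg {p : ℝ} (hp : p ∈ Set.Icc (0 : ℝ) 1) (i : Fin 2) :
    0 ≤ exponentRate p i := by
  revert i
  exact Fin.forall_fin_two.2 ⟨div_nonneg (sub_nonneg.2 hp.2) zero_le_two, hp.1⟩

theorem exists_exponentRate_pos {p : ℝ} (hp : 0 ≤ p) : ∃ i, 0 < exponentRate p i := by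
  rcases hp.eq_or_lt with rfl | hp
  · exact ⟨0, by norm_num [exponentRate]⟩
  · exact ⟨1, hp⟩

theorem affineForm_weightForm_zero_zero_one (i : Fin 2) :
    affineForm (weightForm 0 0 i) 1 = ![4, 2] i := by
  revert i
  rw [weightForm_zero_zero]
  refine Fin.forall_fin_two.2 ⟨?_, ?_⟩ <;> norm_num [affineForm, Complex.inner]

theorem isOptimal_weightForm_zero_zero {p : ℝ} (hp : 0 ≤ p) :
    IsOptimal (exponentRate p) (weightForm 0 0) 1 where
  norm_eq_one := norm_one
  pos := Fin.forall_fin_two.2 (by simp [affineForm_weightForm_zero_zero_one])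
  exists_smul_eq := by
    refine ⟨(1 + p) / 4, by positivity, ?_⟩
    simp only [tangentForm, affineForm_weightForm_zero_zero_one]
    rw [weightForm_zero_zero, Fin.sum_univ_two]
    apply Complex.ext <;> simp [exponentRate]
    ring

theorem logProd_weightForm_zero_zero (p : ℝ) :
    logProd (exponentRate p) (weightForm 0 0) 1 = log 2 := by
  have hlog : log 4 = 2 * log 2 := by
    rw [show (4 : ℝ) = 2 ^ 2 by norm_num, log_pow, Nat.cast_ofNat]
  simp only [logProd, affineForm_weightForm_zero_zero_one, exponentRate, Fin.sum_univ_two,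
    Matrix.cons_val_zero, Matrix.cons_val_one, Matrix.cons_val_fin_one, hlog]
  ring

end WeightForms

section Laplace

open MeasureTheory

variable {F : Filter ℕ} (hF : F ≤ atTop) {s : ℝ}

include hF

theorem tendsto_log_div_of_exp_bounds {a : ℕ → ℝ}
    (hlower : ∀ ε > 0, ∃ K > 0, ∀ᶠ N : ℕ in F, K * exp (N * (s - ε)) ≤ a N)
    (hupper : ∀ ε > 0, ∃ K > 0, ∀ᶠ N : ℕ in F, a N ≤ K * exp (N * (s + ε))) :
    Tendsto (fun N => log (a N) / N) F (𝓝 s) := by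
  have hN_pos : ∀ᶠ N : ℕ in F, (0 : ℝ) < N :=
    ((eventually_gt_atTop 0).filter_mono hF).mono fun N hN => Nat.cast_pos.2 hN
  have hlog : ∀ K > 0, ∀ t : ℝ, ∀ᶠ N : ℕ in F,
      log (K * exp (N * t)) / N = log K / N + t := by
    intro K hK t
    filter_upwards [hN_pos] with N hN
    rw [log_mul hK.ne' (exp_pos _).ne', log_exp, add_div, mul_div_cancel_left₀ _ hN.ne']
  have hlim (K t : ℝ) : Tendsto (fun N : ℕ => log K / N + t) F (𝓝 t) := by
    simpa using ((tendsto_const_div_atTop_nhds_zero_nat (log K)).mono_left hF).add_const t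
  have ha_pos : ∀ᶠ N in F, 0 < a N := by
    obtain ⟨K, hK, hle⟩ := hlower 1 one_pos
    filter_upwards [hle] with N hN using lt_of_lt_of_le (by positivity) hN
  refine tendsto_order.2 ⟨fun t ht => ?_, fun t ht => ?_⟩
  · obtain ⟨K, hK, hle⟩ := hlower ((s - t) / 2) (by linarith)
    filter_upwards [hle, hN_pos, hlog K hK (s - (s - t) / 2),
      (hlim K (s - (s - t) / 2)).eventually_const_lt (by linarith : t < _)] with N hN hpos heq hlt
    exact (hlt.trans_eq heq.symm).trans_le
      (div_le_div_of_nonneg_right (log_le_log (by positivity) hN) hpos.le)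
  · obtain ⟨K, hK, hle⟩ := hupper ((t - s) / 2) (by linarith)
    filter_upwards [hle, hN_pos, ha_pos, hlog K hK (s + (t - s) / 2),
      (hlim K (s + (t - s) / 2)).eventually_lt_const (by linarith : _ < t)]
      with N hN hpos hapos heq hlt
    exact (div_le_div_of_nonneg_right (log_le_log hapos hN) hpos.le).trans_lt (heq.trans_lt hlt)

variable {ι X : Type*} [Fintype ι] {K : Set X} {c : ι → ℝ} {n : ℕ → ι → ℕ}
  (hn : ∀ i, Tendsto (fun N => (n N i : ℝ) / N) F (𝓝 (c i)))

include hn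

theorem eventually_sum_mul_le {b : ι → X → ℝ} {C : ℝ} (hb : ∀ i, ∀ x ∈ K, |b i x| ≤ C)
    (hs : ∀ x ∈ K, ∑ i, c i * b i x ≤ s) {ε : ℝ} (hε : 0 < ε) :
    ∀ᶠ N : ℕ in F, ∀ x ∈ K, ∑ i, n N i * b i x ≤ N * (s + ε) := by
  have herror : Tendsto (fun N : ℕ => ∑ i, |n N i / N - c i| * C) F (𝓝 0) := by
    simpa using tendsto_finsetSum Finset.univ fun i _ =>
      ((hn i).sub_const (c i)).abs.mul_const C
  filter_upwards [herror.eventually_lt_const hε, hF (eventually_gt_atTop 0)] with N herr hN x hx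
  have hN' : (0 : ℝ) < N := Nat.cast_pos.2 hN
  calc ∑ i, n N i * b i x
      = N * (∑ i, c i * b i x + ∑ i, (n N i / N - c i) * b i x) := by
        rw [← Finset.sum_add_distrib, Finset.mul_sum]
        refine Finset.sum_congr rfl fun i _ => ?_
        field_simp
        ring
    _ ≤ N * (s + ∑ i, |n N i / N - c i| * C) := by
        refine mul_le_mul_of_nonneg_left (add_le_add (hs x hx) (Finset.sum_le_sum fun i _ => ?_))
          hN'.le
        exact (le_abs_self _).trans ((abs_mul _ _).trans_le
          (mul_le_mul_of_nonneg_left (hb i x hx) (abs_nonneg _)))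
    _ ≤ N * (s + ε) := by gcongr

variable [TopologicalSpace X] {g : ι → X → ℝ} {x₀ : X}

theorem eventually_prod_pow_le_exp (hK : IsCompact K) (hg : ∀ i, ContinuousOn (g i) K)
    (hg_nonneg : ∀ i, ∀ x ∈ K, 0 ≤ g i x) (hg_pos : ∀ i, 0 < g i x₀)
    (hcert : ∀ x ∈ K, ∑ i, c i * (g i x / g i x₀) ≤ ∑ i, c i) {ε : ℝ} (hε : 0 < ε) :
    ∀ᶠ N : ℕ in F, ∀ x ∈ K,
      ∏ i, g i x ^ n N i ≤ exp (N * (∑ i, c i * log (g i x₀) + ε)) := by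
  set b : ι → X → ℝ := fun i x => g i x / g i x₀ - 1 + log (g i x₀)
  have hb_cont (i : ι) : ContinuousOn (b i) K :=
    (((hg i).div_const _).sub continuousOn_const).add continuousOn_const
  obtain ⟨C, hC⟩ : ∃ C, ∀ i, ∀ x ∈ K, |b i x| ≤ C := by
    choose C hC using fun i => hK.exists_bound_of_continuousOn (hb_cont i)
    obtain ⟨D, hD⟩ := (Set.finite_range C).bddAbove
    exact ⟨D, fun i x hx => (hC i x hx).trans (hD ⟨i, rfl⟩)⟩
  have hg_le (i : ι) (x : X) : g i x ≤ exp (b i x) := calc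
    g i x = g i x / g i x₀ * g i x₀ := (div_mul_cancel₀ _ (hg_pos i).ne').symm
    _ ≤ exp (g i x / g i x₀ - 1) * g i x₀ :=
      mul_le_mul_of_nonneg_right (by linarith [add_one_le_exp (g i x / g i x₀ - 1)]) (hg_pos i).le
    _ = exp (b i x) := by rw [exp_add, exp_log (hg_pos i)]
  have hs : ∀ x ∈ K, ∑ i, c i * b i x ≤ ∑ i, c i * log (g i x₀) := by
    intro x hx
    simp only [b, mul_add, mul_sub, mul_one, Finset.sum_add_distrib, Finset.sum_sub_distrib]
    linarith [hcert x hx]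
  filter_upwards [eventually_sum_mul_le hF hn hC hs hε] with N hN x hx
  calc ∏ i, g i x ^ n N i ≤ ∏ i, exp (b i x) ^ n N i :=
        Finset.prod_le_prod (fun i _ => pow_nonneg (hg_nonneg i x hx) _)
          fun i _ => pow_le_pow_left₀ (hg_nonneg i x hx) (hg_le i x) _
    _ = exp (∑ i, n N i * b i x) := by simp only [← exp_nat_mul, exp_sum]
    _ ≤ _ := exp_le_exp.2 (hN x hx)

theorem exists_nhds_exp_le_prod_pow (hg : ∀ i, ContinuousAt (g i) x₀) (hg_pos : ∀ i, 0 < g i x₀)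
    {ε : ℝ} (hε : 0 < ε) :
    ∃ U ∈ 𝓝 x₀, ∀ᶠ N : ℕ in F, ∀ x ∈ U,
      exp (N * (∑ i, c i * log (g i x₀) - ε)) ≤ ∏ i, g i x ^ n N i := by
  obtain ⟨η, hη, hsmall⟩ : ∃ η > 0, η * ∑ i, c i ≤ ε / 2 := by
    refine ⟨ε / 2 / (1 + |∑ i, c i|), by positivity, ?_⟩
    rw [div_mul_eq_mul_div, div_le_iff₀ (by positivity)]
    nlinarith [le_abs_self (∑ i, c i)]
  refine ⟨{x | ∀ i, exp (log (g i x₀) - η) < g i x}, eventually_all.2 fun i => ?_, ?_⟩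
  · refine (hg i).eventually_const_lt ?_
    calc exp (log (g i x₀) - η) < exp (log (g i x₀)) := exp_lt_exp.2 (sub_lt_self _ hη)
      _ = g i x₀ := exp_log (hg_pos i)
  have hexponent := eventually_sum_mul_le (K := {x₀}) (b := fun i _ => -(log (g i x₀) - η))
    (s := -(∑ i, c i * log (g i x₀) - ε / 2)) hF hn
    (fun i _ _ => Finset.single_le_sum (f := fun i => |-(log (g i x₀) - η)|)
      (fun _ _ => abs_nonneg _) (Finset.mem_univ i))
    (fun _ _ => by
      simp only [mul_neg, Finset.sum_neg_distrib, mul_sub, Finset.sum_sub_distrib, ← Finset.sum_mul]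
      linarith) (half_pos hε)
  filter_upwards [hexponent] with N hN x hx
  have hle := hN x₀ rfl
  simp only [mul_neg, Finset.sum_neg_distrib] at hle
  calc exp (N * (∑ i, c i * log (g i x₀) - ε))
      ≤ exp (∑ i, n N i * (log (g i x₀) - η)) := exp_le_exp.2 (by linarith)
    _ = ∏ i, exp (log (g i x₀) - η) ^ n N i := by simp only [← exp_nat_mul, exp_sum]
    _ ≤ ∏ i, g i x ^ n N i := Finset.prod_le_prod (fun i _ => by positivity) fun i _ =>
        pow_le_pow_left₀ (exp_pos _).le (hx i).le _

/-- Laplace's method. The certificate says that `x₀` maximizes the linearization at `x₀` of the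
exponential rate `∑ i, c i * log (g i x)`. -/
theorem tendsto_log_setIntegral_prod_pow_div [T2Space X] [MeasurableSpace X]
    [OpensMeasurableSpace X] {μ : Measure X} [IsFiniteMeasureOnCompacts μ] [μ.IsOpenPosMeasure]
    (hK : IsCompact K) (hx₀ : K ∈ 𝓝 x₀) (hg : ∀ i, ContinuousOn (g i) K)
    (hg_nonneg : ∀ i, ∀ x ∈ K, 0 ≤ g i x) (hg_pos : ∀ i, 0 < g i x₀)
    (hcert : ∀ x ∈ K, ∑ i, c i * (g i x / g i x₀) ≤ ∑ i, c i) :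
    Tendsto (fun N => log (∫ x in K, ∏ i, g i x ^ n N i ∂μ) / N) F
      (𝓝 (∑ i, c i * log (g i x₀))) := by
  have hint (N : ℕ) : IntegrableOn (fun x => ∏ i, g i x ^ n N i) K μ :=
    (continuousOn_finsetProd _ fun i _ => (hg i).pow _).integrableOn_compact hK
  have hnonneg (N : ℕ) (x : X) (hx : x ∈ K) : 0 ≤ ∏ i, g i x ^ n N i :=
    Finset.prod_nonneg fun i _ => pow_nonneg (hg_nonneg i x hx) _
  have hfinite : μ K ≠ ⊤ := hK.measure_ne_top
  refine tendsto_log_div_of_exp_bounds hF (fun ε hε => ?_) fun ε hε => ?_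
  · obtain ⟨U, hU, hle⟩ := exists_nhds_exp_le_prod_pow hF hn
      (fun i => (hg i).continuousAt hx₀) hg_pos hε
    set V := interior (U ∩ K)
    have hV : V ∈ 𝓝 x₀ := interior_mem_nhds.2 (inter_mem hU hx₀)
    have hVK : V ⊆ K := interior_subset.trans Set.inter_subset_right
    have hV_finite : μ V ≠ ⊤ := measure_ne_top_of_subset hVK hfinite
    refine ⟨μ.real V, ENNReal.toReal_pos (μ.measure_pos_of_mem_nhds hV).ne' hV_finite, ?_⟩
    filter_upwards [hle] with N hN
    calc μ.real V * exp (N * (∑ i, c i * log (g i x₀) - ε))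
        ≤ ∫ x in V, ∏ i, g i x ^ n N i ∂μ :=
          setIntegral_ge_of_const_le isOpen_interior.measurableSet hV_finite
            (fun x hx => hN x (interior_subset hx).1) ((hint N).mono_set hVK)
      _ ≤ ∫ x in K, ∏ i, g i x ^ n N i ∂μ :=
          setIntegral_mono_set (hint N) (ae_restrict_of_forall_mem hK.measurableSet (hnonneg N))
            (.of_forall hVK)
  · refine ⟨μ.real K, ENNReal.toReal_pos (μ.measure_pos_of_mem_nhds hx₀).ne' hfinite, ?_⟩
    filter_upwards [eventually_prod_pow_le_exp hF hn hK hg hg_nonneg hg_pos hcert hε] with N hN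
    rw [mul_comm]
    refine (le_norm_self _).trans (norm_setIntegral_le_of_norm_le_const hfinite.lt_top
      fun x hx => ?_)
    rw [norm_of_nonneg (hnonneg N x hx)]
    exact hN x hx

end Laplace

section DegreeSequences

variable {p : ℝ} {d : ∀ N : ℕ, Fin N → ℕ} {N : ℕ}

/-- The exponents of the two forms of `weightForm` in the integrand of `weightIntegral`. The halving
is exact for the sizes `N` with an even number of half-edges, because then the number of vertices
of degree one is even. -/
def formExponent (p : ℝ) (N : ℕ) : Fin 2 → ℕ := ![(N - ⌊p * N⌋₊) / 2, ⌊p * N⌋₊]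

theorem IsCM12.card_degree_one (hd : IsCM12 p d) (N : ℕ) :
    (Finset.univ.filter fun i => d N i ≠ 2).card = N - ⌊p * N⌋₊ := by
  have hsplit := Finset.card_filter_add_card_filter_not (s := (Finset.univ : Finset (Fin N)))
    (fun i => d N i = 2)
  rw [(hd N).2, Finset.card_univ, Fintype.card_fin] at hsplit
  exact Nat.eq_sub_of_add_eq' hsplit

theorem IsCM12.floor_le (hd : IsCM12 p d) (N : ℕ) : ⌊p * N⌋₊ ≤ N :=
  (hd N).2 ▸ card_finset_fin_le _

@[to_additive]
theorem IsCM12.prod_eq {M : Type*} [CommMonoid M] (hd : IsCM12 p d) (N : ℕ) (V : ℕ → M) :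
    ∏ i, V (d N i) = V 1 ^ (N - ⌊p * N⌋₊) * V 2 ^ ⌊p * N⌋₊ := by
  rw [← Finset.prod_filter_mul_prod_filter_not Finset.univ (fun i => d N i = 2), mul_comm,
    ← hd.card_degree_one, ← (hd N).2]
  congr 1
  · refine Finset.prod_eq_pow_card fun i hi => ?_
    rw [((hd N).1 i).resolve_right (Finset.mem_filter.1 hi).2]
  · refine Finset.prod_eq_pow_card fun i hi => ?_
    rw [(Finset.mem_filter.1 hi).2]

theorem IsCM12.two_mul_formExponent_zero (hd : IsCM12 p d) (hN : Even (∑ i, d N i)) :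
    2 * formExponent p N 0 = N - ⌊p * N⌋₊ := by
  have hsum : ∑ i, d N i = (N - ⌊p * N⌋₊) + ⌊p * N⌋₊ * 2 := by
    simpa using hd.sum_eq N id
  rw [hsum, Nat.even_add] at hN
  exact Nat.two_mul_div_two_of_even (hN.2 (even_two.mul_left _))

theorem admissible_le_atTop : admissible d ≤ atTop := inf_le_left

theorem eventually_admissible : ∀ᶠ N in admissible d, Even (∑ i, d N i) :=
  mem_inf_of_right (mem_principal_self _)

theorem IsCM12.tendsto_formExponent_div (hp : 0 ≤ p) (hd : IsCM12 p d) (i : Fin 2) :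
    Tendsto (fun N => (formExponent p N i : ℝ) / N) (admissible d) (𝓝 (exponentRate p i)) := by
  have hfloor : Tendsto (fun N : ℕ => (⌊p * N⌋₊ : ℝ) / N) (admissible d) (𝓝 p) :=
    ((tendsto_nat_floor_mul_div_atTop hp).comp tendsto_natCast_atTop_atTop).mono_left
      admissible_le_atTop
  revert i
  refine Fin.forall_fin_two.2 ⟨?_, hfloor⟩
  refine ((hfloor.const_sub 1).div_const 2).congr' ?_
  filter_upwards [eventually_admissible, admissible_le_atTop (eventually_gt_atTop 0)] with N hN hpos
  have hcast := congrArg (Nat.cast : ℕ → ℝ) (hd.two_mul_formExponent_zero hN)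
  rw [Nat.cast_mul, Nat.cast_sub (hd.floor_le N), Nat.cast_ofNat] at hcast
  have hpos' : (N : ℝ) ≠ 0 := Nat.cast_ne_zero.2 hpos.ne'
  field_simp
  linarith

end DegreeSequences

section Pressure

variable {p : ℝ} {d : ∀ N : ℕ, Fin N → ℕ} {N : ℕ}

@[fun_prop]
theorem continuous_vertexWeight (β B : ℝ) (k : ℕ) : Continuous (vertexWeight β B k) := by
  unfold vertexWeight
  fun_prop

theorem vertexWeight_apply_zero_pos (β B : ℝ) (k : ℕ) : 0 < vertexWeight β B k 0 := by
  refine Finset.sum_pos (fun t _ => mul_pos (exp_pos _) (pow_pos ?_ k)) Finset.univ_nonempty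
  simpa [circleForm, spinVector] using cosh_pos β

theorem affineForm_weightForm_nonneg (β B θ : ℝ) (i : Fin 2) :
    0 ≤ affineForm (weightForm β B i) (Complex.exp ((2 * θ : ℝ) * Complex.I)) := by
  revert i
  refine Fin.forall_fin_two.2 ⟨?_, ?_⟩
  · exact vertexWeight_one_sq β B θ ▸ sq_nonneg _
  · exact vertexWeight_two β B θ ▸ Finset.sum_nonneg fun t _ => by positivity

theorem IsCM12.prod_vertexWeight (hd : IsCM12 p d) (hN : Even (∑ i, d N i)) (β B θ : ℝ) :
    ∏ i, vertexWeight β B (d N i) θ =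
      ∏ i, affineForm (weightForm β B i) (Complex.exp ((2 * θ : ℝ) * Complex.I)) ^
        formExponent p N i := by
  rw [hd.prod_eq N fun k => vertexWeight β B k θ, Fin.prod_univ_two, ← vertexWeight_one_sq,
    ← vertexWeight_two, ← pow_mul, hd.two_mul_formExponent_zero hN]
  rfl

theorem IsCM12.weightIntegral_pos (hd : IsCM12 p d) (hN : Even (∑ i, d N i)) (β B : ℝ) :
    0 < weightIntegral (d N) β B := by
  refine intervalIntegral.integral_pos (by linarith [pi_pos])
    (Continuous.continuousOn (by fun_prop)) (fun θ _ => ?_)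
    ⟨0, ⟨by linarith [pi_pos], pi_pos.le⟩,
      Finset.prod_pos fun i _ => vertexWeight_apply_zero_pos β B _⟩
  rw [hd.prod_vertexWeight hN]
  exact Finset.prod_nonneg fun i _ => pow_nonneg (affineForm_weightForm_nonneg β B θ i) _

theorem IsCM12.graphExpect_partitionFn_pos (hd : IsCM12 p d) (hN : Even (∑ i, d N i)) {β : ℝ}
    (hβ : 0 ≤ β) (B : ℝ) : 0 < graphExpect (d N) (partitionFn β B) := by
  rw [graphExpect_partitionFn (d N) B hβ]
  exact mul_pos (by positivity)
    (div_pos (hd.weightIntegral_pos hN β B) (hd.weightIntegral_pos hN 0 0))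

theorem IsCM12.tendsto_log_weightIntegral_div (hp : 0 ≤ p) (hd : IsCM12 p d) {β B φ : ℝ}
    (hφ : φ ∈ Set.Icc (-(π / 2)) (π / 2))
    (hopt : IsOptimal (exponentRate p) (weightForm β B) (Complex.exp (φ * Complex.I))) :
    Tendsto (fun N : ℕ => log (weightIntegral (d N) β B) / N) (admissible d)
      (𝓝 (logProd (exponentRate p) (weightForm β B) (Complex.exp (φ * Complex.I)))) := by
  have hdouble : Complex.exp ((2 * (φ / 2) : ℝ) * Complex.I) = Complex.exp (φ * Complex.I) := by
    rw [mul_div_cancel₀ φ two_ne_zero]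
  have hnhds : Set.Icc (-π) π ∈ 𝓝 (φ / 2) :=
    Icc_mem_nhds (by linarith [hφ.1, pi_pos]) (by linarith [hφ.2, pi_pos])
  have hlaplace := tendsto_log_setIntegral_prod_pow_div (μ := MeasureTheory.volume)
    (g := fun i θ => affineForm (weightForm β B i) (Complex.exp ((2 * θ : ℝ) * Complex.I)))
    admissible_le_atTop (hd.tendsto_formExponent_div hp) isCompact_Icc hnhds
    (fun i => Continuous.continuousOn (by fun_prop))
    (fun i θ _ => affineForm_weightForm_nonneg β B θ i)
    (fun i => by rw [hdouble]; exact hopt.pos i)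
    (fun θ _ => by
      rw [hdouble, ← affineForm_tangentForm]
      exact hopt.affineForm_tangentForm_le (Complex.norm_exp_ofReal_mul_I _).le)
  simp only [hdouble] at hlaplace
  refine hlaplace.congr' ?_
  filter_upwards [eventually_admissible] with N hN
  simp only [weightIntegral, hd.prod_vertexWeight hN,
    intervalIntegral.integral_of_le (show -π ≤ π by linarith [pi_pos]),
    MeasureTheory.integral_Icc_eq_integral_Ioc]

theorem IsCM12.tendsto_annealedPressure (hp : 0 ≤ p) (hd : IsCM12 p d) {β B φ : ℝ} (hβ : 0 ≤ β)
    (hφ : φ ∈ Set.Icc (-(π / 2)) (π / 2))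
    (hopt : IsOptimal (exponentRate p) (weightForm β B) (Complex.exp (φ * Complex.I))) :
    Tendsto (fun N => annealedPressure (d N) β B) (admissible d)
      (𝓝 (logProd (exponentRate p) (weightForm β B) (Complex.exp (φ * Complex.I)))) := by
  have hzero : Tendsto (fun N : ℕ => log (weightIntegral (d N) 0 0) / N) (admissible d)
      (𝓝 (log 2)) := by
    have hone : Complex.exp ((0 : ℝ) * Complex.I) = 1 := by simp
    have hlim := hd.tendsto_log_weightIntegral_div hp (β := 0) (B := 0) (φ := 0)
      ⟨by linarith [pi_pos], by linarith [pi_pos]⟩ (hone ▸ isOptimal_weightForm_zero_zero hp)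
    rwa [hone, logProd_weightForm_zero_zero] at hlim
  have hsum := ((hd.tendsto_log_weightIntegral_div hp hφ hopt).sub hzero).const_add (log 2)
  rw [add_sub_cancel] at hsum
  refine hsum.congr' ?_
  filter_upwards [eventually_admissible, admissible_le_atTop (eventually_gt_atTop 0)] with N hN hpos
  have hpos' : (N : ℝ) ≠ 0 := Nat.cast_ne_zero.2 hpos.ne'
  have hI := (hd.weightIntegral_pos hN β B).ne'
  have hI₀ := (hd.weightIntegral_pos hN 0 0).ne'
  rw [annealedPressure, graphExpect_partitionFn (d N) B hβ,
    log_mul (by positivity) (div_ne_zero hI hI₀), log_div hI hI₀, log_pow]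
  field_simp

end Pressure

section AnnealedMeasure

variable {N : ℕ} {d : Fin N → ℕ} {β B : ℝ}

theorem graphExpect_nonneg {X : Equiv.Perm (HalfEdge d) → ℝ} (hX : ∀ τ, 0 ≤ X τ) :
    0 ≤ graphExpect d X :=
  div_nonneg (Finset.sum_nonneg fun τ _ => hX τ) (Nat.cast_nonneg _)

theorem annealedMass_nonneg (σ : Spins N) : 0 ≤ annealedMass d β B σ :=
  div_nonneg (graphExpect_nonneg fun _ => (exp_pos _).le)
    (graphExpect_nonneg fun _ => Finset.sum_nonneg fun _ _ => (exp_pos _).le)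

theorem annealedProb_nonneg (A : Set (Spins N)) : 0 ≤ annealedProb d β B A :=
  Finset.sum_nonneg fun _ _ => Set.indicator_nonneg (fun _ _ => annealedMass_nonneg _) _

theorem annealedProb_mono {A A' : Set (Spins N)} (h : A ⊆ A') :
    annealedProb d β B A ≤ annealedProb d β B A' :=
  Finset.sum_le_sum fun σ _ => Set.indicator_le_indicator_of_subset h annealedMass_nonneg σ

theorem annealedProb_union_le (A A' : Set (Spins N)) :
    annealedProb d β B (A ∪ A') ≤ annealedProb d β B A + annealedProb d β B A' := by
  simp only [annealedProb, ← Finset.sum_add_distrib]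
  refine Finset.sum_le_sum fun σ _ => ?_
  rw [← Set.indicator_union_add_inter_apply]
  exact le_add_of_nonneg_right (Set.indicator_nonneg (fun _ _ => annealedMass_nonneg _) _)

theorem sum_graphExpect_boltzmann (d : Fin N → ℕ) (β B : ℝ) :
    ∑ σ : Spins N, graphExpect d (fun τ => boltzmann β B τ σ) =
      graphExpect d (partitionFn β B) := by
  simp only [graphExpect, partitionFn, ← Finset.sum_div]
  rw [Finset.sum_comm]

theorem sum_annealedMass (hZ : 0 < graphExpect d (partitionFn β B)) :
    ∑ σ : Spins N, annealedMass d β B σ = 1 := by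
  simp only [annealedMass, ← Finset.sum_div]
  rw [sum_graphExpect_boltzmann, div_self hZ.ne']

theorem boltzmann_mul_exp (τ : Equiv.Perm (HalfEdge d)) (σ : Spins N) (t : ℝ) :
    boltzmann β B τ σ * exp (t * totalSpin σ) = boltzmann β (B + t) τ σ := by
  rw [boltzmann, boltzmann, ← exp_add, add_mul, add_assoc]

theorem sum_annealedMass_mul_exp (t : ℝ) :
    ∑ σ : Spins N, annealedMass d β B σ * exp (t * totalSpin σ) =
      graphExpect d (partitionFn β (B + t)) / graphExpect d (partitionFn β B) := by
  rw [← sum_graphExpect_boltzmann d β (B + t), Finset.sum_div]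
  simp only [annealedMass, graphExpect, div_mul_eq_mul_div, Finset.sum_mul, boltzmann_mul_exp]

/-- The Chernoff bound, with the exponential tilt `t` absorbed into the external field. -/
theorem annealedProb_le_exp (hN : 0 < N) {t : ℝ} (hZ : 0 < graphExpect d (partitionFn β B))
    (hZt : 0 < graphExpect d (partitionFn β (B + t))) {A : Set (Spins N)} {x : ℝ}
    (hA : ∀ σ ∈ A, t * x ≤ t * (totalSpin σ / N)) :
    annealedProb d β B A ≤
      exp (N * (annealedPressure d β (B + t) - annealedPressure d β B - t * x)) := by
  have hN' : (0 : ℝ) < N := Nat.cast_pos.2 hN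
  have hindicator (σ : Spins N) : A.indicator (annealedMass d β B) σ ≤
      annealedMass d β B σ * exp (t * totalSpin σ) * exp (-(N * (t * x))) := by
    refine Set.indicator_apply_le' (fun hσ => ?_) fun _ =>
      mul_nonneg (mul_nonneg (annealedMass_nonneg σ) (exp_pos _).le) (exp_pos _).le
    have hle : N * (t * x) ≤ t * totalSpin σ := calc
      N * (t * x) ≤ N * (t * (totalSpin σ / N)) := mul_le_mul_of_nonneg_left (hA σ hσ) hN'.le
      _ = t * totalSpin σ := by field_simp
    rw [mul_assoc, ← exp_add]
    exact le_mul_of_one_le_right (annealedMass_nonneg σ) (one_le_exp (by linarith))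
  calc annealedProb d β B A
      ≤ ∑ σ : Spins N, annealedMass d β B σ * exp (t * totalSpin σ) * exp (-(N * (t * x))) :=
        Finset.sum_le_sum fun σ _ => hindicator σ
    _ = exp (log (graphExpect d (partitionFn β (B + t))) -
          log (graphExpect d (partitionFn β B)) + -(N * (t * x))) := by
        rw [← Finset.sum_mul, sum_annealedMass_mul_exp, exp_add, exp_sub, exp_log hZt, exp_log hZ]
    _ = _ := by
        rw [annealedPressure, annealedPressure]
        field_simp
        ring_nf

theorem abs_totalSpin_div_le (σ : Spins N) : |totalSpin σ / N| ≤ 1 := by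
  have habs (i : Fin N) : |spin σ i| = 1 := by
    rcases Int.units_eq_one_or (σ i) with h | h <;> simp [spin, h]
  rw [abs_div, Nat.abs_cast]
  refine div_le_one_of_le₀ ((Finset.abs_sum_le_sum_abs _ _).trans_eq ?_) (Nat.cast_nonneg _)
  simp only [habs, Finset.sum_const, Finset.card_univ, Fintype.card_fin, nsmul_eq_mul, mul_one]

theorem abs_annealedMagnetization_sub_le (hZ : 0 < graphExpect d (partitionFn β B)) {m ε : ℝ}
    (hε : 0 ≤ ε) :
    |annealedMagnetization d β B - m| ≤
      ε + (1 + |m|) * annealedProb d β B {σ | ε ≤ |totalSpin σ / N - m|} := by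
  set A : Set (Spins N) := {σ | ε ≤ |totalSpin σ / N - m|}
  have hdev (σ : Spins N) : |annealedMass d β B σ * (totalSpin σ / N - m)| ≤
      annealedMass d β B σ * ε + (1 + |m|) * A.indicator (annealedMass d β B) σ := by
    have hmass := annealedMass_nonneg (d := d) (β := β) (B := B) σ
    rw [abs_mul, abs_of_nonneg hmass]
    by_cases hσ : σ ∈ A
    · rw [Set.indicator_of_mem hσ, mul_comm (1 + |m|)]
      exact le_add_of_nonneg_of_le (mul_nonneg hmass hε) (mul_le_mul_of_nonneg_left
        ((abs_sub _ _).trans (add_le_add_left (abs_totalSpin_div_le σ) _)) hmass)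
    · rw [Set.indicator_of_notMem hσ, mul_zero, add_zero]
      exact mul_le_mul_of_nonneg_left (not_le.1 hσ).le hmass
  calc |annealedMagnetization d β B - m|
      = |∑ σ : Spins N, annealedMass d β B σ * (totalSpin σ / N - m)| := by
        simp only [mul_sub, Finset.sum_sub_distrib, ← Finset.sum_mul, sum_annealedMass hZ, one_mul,
          annealedMagnetization]
    _ ≤ ∑ σ : Spins N, (annealedMass d β B σ * ε +
          (1 + |m|) * A.indicator (annealedMass d β B) σ) :=
        (Finset.abs_sum_le_sum_abs _ _).trans (Finset.sum_le_sum fun σ _ => hdev σ)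
    _ = ε + (1 + |m|) * annealedProb d β B A := by
        rw [Finset.sum_add_distrib, ← Finset.sum_mul, ← Finset.mul_sum, sum_annealedMass hZ,
          one_mul, annealedProb]

end AnnealedMeasure

section ExponentialDecay

variable {F : Filter ℕ} {a b : ℕ → ℝ}

/-- The sequence `a` is bounded along `F` by `exp (-(N * L))` for some rate `L > 0`; no constant is
allowed in front. -/
def DecaysExponentially (F : Filter ℕ) (a : ℕ → ℝ) : Prop :=
  ∃ L : ℝ, 0 < L ∧ ∀ᶠ N : ℕ in F, a N ≤ exp (-(N * L))

theorem DecaysExponentially.mono (hb : DecaysExponentially F b) (hab : ∀ N, a N ≤ b N) :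
    DecaysExponentially F a :=
  hb.imp fun _ hL => hL.imp_right fun h => h.mono fun N hN => (hab N).trans hN

theorem DecaysExponentially.add (hF : F ≤ atTop) (ha : DecaysExponentially F a)
    (hb : DecaysExponentially F b) : DecaysExponentially F fun N => a N + b N := by
  obtain ⟨L, hL, ha⟩ := ha
  obtain ⟨L', hL', hb⟩ := hb
  set l := min L L' / 2 with hl
  have hl_pos : 0 < l := half_pos (lt_min hL hL')
  have hlarge : ∀ᶠ N : ℕ in F, log 2 ≤ N * l :=
    hF ((tendsto_natCast_atTop_atTop.atTop_mul_const hl_pos).eventually_ge_atTop _)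
  have hexp_le (N : ℕ) {r : ℝ} (hr : 2 * l ≤ r) : exp (-(N * r)) ≤ exp (-(N * (2 * l))) := by
    gcongr
  refine ⟨l, hl_pos, ?_⟩
  filter_upwards [ha, hb, hlarge] with N haN hbN hN
  calc a N + b N ≤ exp (-(N * (2 * l))) + exp (-(N * (2 * l))) :=
        add_le_add (haN.trans (hexp_le N (by linarith [min_le_left L L'])))
          (hbN.trans (hexp_le N (by linarith [min_le_right L L'])))
    _ = exp (log 2 - N * (2 * l)) := by
        rw [← two_mul, sub_eq_add_neg, exp_add, exp_log two_pos]
    _ ≤ exp (-(N * l)) := exp_le_exp.2 (by linarith)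

theorem DecaysExponentially.tendsto_zero (hF : F ≤ atTop) (ha : DecaysExponentially F a)
    (ha_nonneg : ∀ N, 0 ≤ a N) : Tendsto a F (𝓝 0) := by
  obtain ⟨L, hL, hle⟩ := ha
  exact squeeze_zero' (.of_forall ha_nonneg) hle (tendsto_exp_neg_atTop_nhds_zero.comp
    ((tendsto_natCast_atTop_atTop.atTop_mul_const hL).mono_left hF))

theorem decaysExponentially_of_tendsto {r : ℕ → ℝ} {s : ℝ}
    (hr : Tendsto r F (𝓝 s)) (hs : s < 0) (ha : ∀ᶠ N : ℕ in F, a N ≤ exp (N * r N)) :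
    DecaysExponentially F a := by
  refine ⟨-(s / 2), by linarith, ?_⟩
  filter_upwards [ha, hr.eventually_le_const (by linarith : s < s / 2)] with N haN hrN
  rw [mul_neg, neg_neg]
  exact haN.trans (by gcongr)

end ExponentialDecay

section Concentration

variable {ψ : ℝ → ℝ} {β B m : ℝ}

theorem exists_sub_lt_mul_of_hasDerivAt (hψ' : HasDerivAt ψ m B) {x : ℝ} (hx : x ≠ m) :
    ∃ η > 0, ψ (B + η * (x - m)) - ψ B < η * (x - m) * x := by
  have hline : HasDerivAt (fun η => ψ (B + η * (x - m))) (m * (x - m)) 0 := by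
    refine HasDerivAt.comp 0 (by simpa using hψ') ?_
    simpa using ((hasDerivAt_id (0 : ℝ)).mul_const (x - m)).const_add B
  have hslope : m * (x - m) < (x - m) * x := by nlinarith [sq_pos_of_ne_zero (sub_ne_zero.2 hx)]
  obtain ⟨η, hlt, hη⟩ :=
    ((hline.tendsto_slope_zero_right.eventually_lt_const hslope).and self_mem_nhdsWithin).exists
  have hη_pos : 0 < η := hη
  simp only [zero_add, zero_mul, add_zero, smul_eq_mul, inv_mul_lt_iff₀ hη_pos] at hlt
  exact ⟨η, hη_pos, by rwa [mul_assoc]⟩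

variable {d : ∀ N : ℕ, Fin N → ℕ} {F : Filter ℕ} (hF : F ≤ atTop)
  (hZ : ∀ b, ∀ᶠ N in F, 0 < graphExpect (d N) (partitionFn β b))
  (hψ : ∀ b, Tendsto (fun N => annealedPressure (d N) β b) F (𝓝 (ψ b)))
  (hψ' : HasDerivAt ψ m B)

include hF hZ hψ hψ'

theorem decaysExponentially_annealedProb_tail {x : ℝ} (hx : x ≠ m) :
    DecaysExponentially F fun N =>
      annealedProb (d N) β B {σ | 0 ≤ (x - m) * (totalSpin σ / N - x)} := by
  obtain ⟨η, hη, hlt⟩ := exists_sub_lt_mul_of_hasDerivAt hψ' hx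
  refine decaysExponentially_of_tendsto
    (((hψ (B + η * (x - m))).sub (hψ B)).sub_const (η * (x - m) * x)) (sub_neg.2 hlt) ?_
  filter_upwards [hZ B, hZ (B + η * (x - m)), hF (eventually_gt_atTop 0)] with N hZN hZtN hN
  refine annealedProb_le_exp hN hZN hZtN fun σ hσ => ?_
  rw [← sub_nonneg, ← mul_sub, mul_assoc]
  exact mul_nonneg hη.le hσ

theorem decaysExponentially_annealedProb {ε : ℝ} (hε : 0 < ε) :
    DecaysExponentially F fun N =>
      annealedProb (d N) β B {σ | ε ≤ |totalSpin σ / N - m|} := by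
  have hupper := decaysExponentially_annealedProb_tail hF hZ hψ hψ' (lt_add_of_pos_right m hε).ne'
  have hlower := decaysExponentially_annealedProb_tail hF hZ hψ hψ' (sub_lt_self m hε).ne
  refine (hupper.add hF hlower).mono fun N => (annealedProb_mono fun σ hσ => ?_).trans
    (annealedProb_union_le _ _)
  rw [add_sub_cancel_left, sub_sub_cancel_left]
  rcases le_abs.1 (show ε ≤ |totalSpin σ / N - m| from hσ) with h | h
  · exact Or.inl (mul_nonneg hε.le (by linarith : 0 ≤ totalSpin σ / N - (m + ε)))
  · exact Or.inr (mul_nonneg_of_nonpos_of_nonpos (neg_nonpos.2 hε.le)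
      (by linarith : totalSpin σ / N - (m - ε) ≤ 0))

theorem tendsto_annealedMagnetization :
    Tendsto (fun N => annealedMagnetization (d N) β B) F (𝓝 m) := by
  refine Metric.tendsto_nhds.2 fun ε hε => ?_
  have hprob := ((decaysExponentially_annealedProb hF hZ hψ hψ' (half_pos hε)).tendsto_zero hF
    fun _ => annealedProb_nonneg _).const_mul (1 + |m|)
  rw [mul_zero] at hprob
  filter_upwards [hZ B, hprob.eventually_lt_const (half_pos hε)] with N hZN hN
  rw [dist_eq]
  linarith [abs_annealedMagnetization_sub_le (m := m) hZN (half_pos hε).le]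

end Concentration

end AnnealedIsing

end

theorem mainTheorem8 (p : ℝ) (hp : p ∈ Set.Icc (0 : ℝ) 1) :
    ∃ ψ M : ℝ → ℝ → ℝ,
      ∀ d : (∀ N : ℕ, Fin N → ℕ), AnnealedIsing.IsCM12 p d →
      ∀ β : ℝ, 0 ≤ β → ∀ B : ℝ,
        -- the limiting annealed magnetization `M β B` exists and is the `B`-derivative
        -- of the limiting annealed pressure
        Tendsto (fun N => AnnealedIsing.annealedPressure (d N) β B)
          (AnnealedIsing.admissible d) (𝓝 (ψ β B)) ∧
        Tendsto (fun N => AnnealedIsing.annealedMagnetization (d N) β B)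
          (AnnealedIsing.admissible d) (𝓝 (M β B)) ∧
        HasDerivAt (fun b => ψ β b) (M β B) B ∧
        -- exponential concentration of the total spin
        ∀ ε : ℝ, 0 < ε → ∃ L : ℝ, 0 < L ∧
          ∀ᶠ N : ℕ in AnnealedIsing.admissible d,
            AnnealedIsing.annealedProb (d N) β B
              {σ | ε ≤ |AnnealedIsing.totalSpin σ / N - M β B|} ≤ Real.exp (-(N * L)) := by
  have hmax (β B : ℝ) := AnnealedIsing.exists_isOptimal (AnnealedIsing.exponentRate_nonneg hp)
    (AnnealedIsing.exists_exponentRate_pos hp.1) (AnnealedIsing.norm_snd_weightForm_le β B)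
    (AnnealedIsing.re_snd_weightForm_pos β B)
  choose φ hφ hopt using hmax
  refine ⟨fun β B => AnnealedIsing.logProd (AnnealedIsing.exponentRate p)
      (AnnealedIsing.weightForm β B) (Complex.exp (φ β B * Complex.I)),
    fun β B => AnnealedIsing.affineForm (AnnealedIsing.tangentForm (AnnealedIsing.exponentRate p)
      (AnnealedIsing.weightForm β B) (Complex.exp (φ β B * Complex.I))
      (deriv (AnnealedIsing.weightForm β) B)) (Complex.exp (φ β B * Complex.I)),
    fun d hd β hβ B => ?_⟩
  have hψ (b : ℝ) := hd.tendsto_annealedPressure hp.1 hβ (hφ β b) (hopt β b)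
  have hψ' := AnnealedIsing.hasDerivAt_logProd_of_isOptimal
    (AnnealedIsing.exponentRate_nonneg hp) (AnnealedIsing.differentiable_weightForm β B).hasDerivAt
    (hopt β)
  have hZ (b : ℝ) := AnnealedIsing.eventually_admissible.mono
    fun N hN => hd.graphExpect_partitionFn_pos (N := N) hN hβ b
  have hF := AnnealedIsing.admissible_le_atTop (d := d)
  exact ⟨hψ B, AnnealedIsing.tendsto_annealedMagnetization hF hZ hψ hψ', hψ',
    fun ε => AnnealedIsing.decaysExponentially_annealedProb hF hZ hψ hψ'⟩
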